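/- Let $N\ge 1$, let $l\in C(\mathbb R^N)$ with $l\ge 0$, and let $H\in C(\mathbb R^N\times\mathbb R^N)$. A solution of the ergodic problem $$H(x,Dv(x))=l(x)+c\quad\text{in }\mathbb R^N \qquad (E)$$ is a pair $(c,v)\in[0,\infty)\times C(\mathbb R^N)$ such that $v$ is a viscosity solution of (E). Let $\mathcal A=\{x\in\mathbb R^N: l(x)=0\}$ (when $\mathcal A\neq\emptyset$, this is $\operatorname{argmin} l$, and $\inf l=0$). Consider the conditions - (Coercivity) there is $\nu\in C(\mathbb R^N)$, $\nu>0$, with $H(x,p)\ge\nu(x)|p|$ for all $x,p$; - (Strict minimum) $0=H(x,0)<H(x,p)$ for all $x$ and all $p\ne0$; - (Convexity) $H(x,\cdot)$ is convex for all $x$; - (Growth) $H(x,p)\le m(|p|)$ for all $x,p$, for some nondecreasing $m\in C([0,\infty),[0,\infty))$ with $m(0)=0$; - (Compactness) $\liminf_{|x|\to\infty}l(x)>\inf_{\mathbb R^N}l=0$. (i) If $H$ satisfies (Coercivity) and $H(x,0)=0$ for all $x$, then for every $c\ge0$ there is a solution $(c,v)$ of (E) with $v$ locally Lipschitz, that is,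 $v\in W^{1,\infty}_{\rm loc}(\mathbb R^N)$. (ii) Assume that the Cauchy problem $u_t+H(x,Du)=l(x)$ in $\mathbb R^N\times(0,\infty)$, $u(\cdot,0)=u_0$, satisfies a comparison principle in $C(\mathbb R^N\times[0,\infty))$: if $U,V\in C(\mathbb R^N\times[0,\infty))$ are a viscosity subsolution and a viscosity supersolution of the equation with $U(\cdot,0)\le V(\cdot,0)$, then $U\le V$ on $\mathbb R^N\times[0,\infty)$. If $(c,v)$ and $(d,w)$ are solutions of (E) (with constants $c$ and $d$ respectively) and $\sup_{\mathbb R^N}|v-w|<\infty$, then $c=d$. (iii) If $\mathcal A\ne\emptyset$ and $H$ satisfies (Coercivity) and (Strict minimum), then there is a solution $(0,v)$ of (E) with $v$ locally Lipschitz and $v\ge0$. If, in addition, (Growth) and (Compactness) hold, then $v(x)\to+\infty$ as $|x|\to\infty$ for every solution $(0,v)$ of (E) with $v\ge0$. (iv) Let $c>0$. If $H$ satisfies (Growth), then for every solution $(c,v)$ of (E) the function $v$ is unbounded from below. If $H(x,0)=0$ for all $x$ and $H$ satisfies (Convexity), if $(c,v)$ and $(c,w)$ are two solutions of (E) with $v(x)-w(x)\to0$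 as $|x|\to\infty$, and if $H$ satisfies (Coercivity) or $v$ and $w$ are both locally Lipschitz, then $v=w$. -/

import Mathlib

open Set Filter Topology

namespace ErgodicHJ

/-- `ℝ^N` with its Euclidean norm. -/
abbrev E (N : ℕ) : Type := EuclideanSpace ℝ (Fin N)

/-- `v` is a viscosity subsolution of `H(x, Dv) = f(x)` in `ℝ^N`. -/
def IsViscSub {N : ℕ} (H : E N → E N → ℝ) (f v : E N → ℝ) : Prop :=
  ∀ φ : E N → ℝ, ContDiff ℝ 1 φ → ∀ x : E N,
    IsLocalMax (fun y => v y - φ y) x → H x (gradient φ x) ≤ f x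

/-- `v` is a viscosity supersolution of `H(x, Dv) = f(x)` in `ℝ^N`. -/
def IsViscSuper {N : ℕ} (H : E N → E N → ℝ) (f v : E N → ℝ) : Prop :=
  ∀ φ : E N → ℝ, ContDiff ℝ 1 φ → ∀ x : E N,
    IsLocalMin (fun y => v y - φ y) x → f x ≤ H x (gradient φ x)

/-- `(c, v) ∈ ℝ₊ × C(ℝ^N)` is a (viscosity) solution of the ergodic problem
`H(x, Dv(x)) = l(x) + c` in `ℝ^N`. -/
structure IsErgodicSolution {N : ℕ} (H : E N → E N → ℝ) (l : E N → ℝ)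
    (c : ℝ) (v : E N → ℝ) : Prop where
  nonneg : 0 ≤ c
  continuous : Continuous v
  sub : IsViscSub H (fun x => l x + c) v
  super : IsViscSuper H (fun x => l x + c) v

/-- `U` is a viscosity subsolution of `u_t + H(x, Du) = l(x)` in `ℝ^N × (0, ∞)`. -/
def IsCauchySub {N : ℕ} (H : E N → E N → ℝ) (l : E N → ℝ) (U : E N × ℝ → ℝ) : Prop :=
  ∀ φ : E N × ℝ → ℝ, ContDiffOn ℝ 1 φ (univ ×ˢ Ioi 0) → ∀ (x : E N) (t : ℝ), 0 < t →
    IsLocalMax (fun z => U z - φ z) (x, t) →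
    deriv (fun s => φ (x, s)) t + H x (gradient (fun y => φ (y, t)) x) ≤ l x

/-- `V` is a viscosity supersolution of `u_t + H(x, Du) = l(x)` in `ℝ^N × (0, ∞)`. -/
def IsCauchySuper {N : ℕ} (H : E N → E N → ℝ) (l : E N → ℝ) (V : E N × ℝ → ℝ) : Prop :=
  ∀ φ : E N × ℝ → ℝ, ContDiffOn ℝ 1 φ (univ ×ˢ Ioi 0) → ∀ (x : E N) (t : ℝ), 0 < t →
    IsLocalMin (fun z => V z - φ z) (x, t) →
    l x ≤ deriv (fun s => φ (x, s)) t + H x (gradient (fun y => φ (y, t)) x)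

/-- The comparison principle in `C(ℝ^N × [0, ∞))` for the Cauchy problem
`u_t + H(x, Du) = l(x)`, `u(·, 0) = u₀`: a continuous subsolution that lies below a continuous
supersolution at time `0` lies below it at all times. -/
def ComparisonPrinciple {N : ℕ} (H : E N → E N → ℝ) (l : E N → ℝ) : Prop :=
  ∀ U V : E N × ℝ → ℝ,
    ContinuousOn U (univ ×ˢ Ici 0) → ContinuousOn V (univ ×ˢ Ici 0) →
    IsCauchySub H l U → IsCauchySuper H l V →
    (∀ x, U (x, 0) ≤ V (x, 0)) → ∀ (x : E N) (t : ℝ), 0 ≤ t → U (x, t) ≤ V (x, t)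

/-- Coercivity: `H(x, p) ≥ ν(x)|p|` for some positive continuous `ν`. -/
def Coercive {N : ℕ} (H : E N → E N → ℝ) : Prop :=
  ∃ ν : E N → ℝ, Continuous ν ∧ (∀ x, 0 < ν x) ∧ ∀ x p, ν x * ‖p‖ ≤ H x p

/-- `0 = H(x, 0) < H(x, p)` for `p ≠ 0`. -/
def StrictlyMinimalAtZero {N : ℕ} (H : E N → E N → ℝ) : Prop :=
  ∀ x, H x 0 = 0 ∧ ∀ p, p ≠ 0 → 0 < H x p

/-- `H(x, ·)` is convex for every `x`. -/
def ConvexInMomentum {N : ℕ} (H : E N → E N → ℝ) : Prop :=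
  ∀ x, ConvexOn ℝ univ (H x)

/-- `H(x, p) ≤ m(|p|)` for some nondecreasing continuous `m : ℝ₊ → ℝ₊` with `m(0) = 0`. -/
def GrowthBound {N : ℕ} (H : E N → E N → ℝ) : Prop :=
  ∃ m : NNReal → NNReal, Continuous m ∧ Monotone m ∧ m 0 = 0 ∧ ∀ x p, H x p ≤ m ‖p‖₊

/-- The set `𝒜 = {x : l(x) = 0}`. Under the normalization `inf l = 0` this is `argmin l`;
for `l ≥ 0`, if it is nonempty, then `inf l = 0` and it is `argmin l`. -/
def argminSet {N : ℕ} (l : E N → ℝ) : Set (E N) :=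
  {x | l x = 0}

/-- `liminf_{|x| → ∞} l(x) > inf l = 0`; the lower limit may be `+∞`. -/
def CompactnessCondition {N : ℕ} (l : E N → ℝ) : Prop :=
  IsGLB (range l) 0 ∧
    (0 : EReal) < liminf (fun x => (l x : EReal)) (Bornology.cobounded (E N))

end ErgodicHJ

open ErgodicHJ

namespace ErgodicHJ

variable {N : ℕ}

/-! ### Calculus of test functions -/

/-! Existence rests on Perron's method. By coercivity, every subsolution satisfies `|Dw| ≤ f/ν` with
`f = l + c`, so subsolutions are equi-Lipschitz on balls (`Coercive.subsolutionsEquiLipschitz`). The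
zero function is a subsolution, and the envelope of the subsolutions that are nonpositive on a
closed nonempty set `K` is a subsolution everywhere and a supersolution off `K`. For (i), `K` is a
point sent to infinity; the envelopes, normalized at the origin, have a locally uniform limit, which
solves the equation on the whole space. For (iii), `K` is the zero set of `l`: there the
supersolution test with `c = 0` only asks `H ≥ 0`.

The growth statements in (iii) and (iv) come from one estimate (`add_le_of_isViscSuperOn`): a
supersolution of `|Dv| = ρ` on a ball of radius `r` exceeds its lower bound by at least `ρ r / 4` at
the centre. The growth bound on `H` turns a positive right-hand side into such a slope `ρ`.

For (ii), `v - M - ct` and `w - dt` are ordered at time `0`, hence always, and letting `t` grow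
compares the constants.

For uniqueness in (iv), convexity and `H(x, 0) = 0` make `μv` with `μ < 1` a subsolution for `μ(l +
c)`, strictly below `l + c` because `c > 0`. Doubling of variables then moves any positive value of
`v - w`, up to a small error, to a distant sphere, where `v - w` is small. -/

lemma contDiff_add_mul_norm_sub_sq {φ : E N → ℝ} (hφ : ContDiff ℝ 1 φ) (a : ℝ) (z : E N) :
    ContDiff ℝ 1 (fun y => φ y + a * ‖y - z‖ ^ 2) :=
  hφ.add (contDiff_const.mul ((contDiff_id.sub contDiff_const).norm_sq ℝ))

lemma gradient_add_mul_norm_sub_sq {φ : E N → ℝ} {x : E N} (hφ : DifferentiableAt ℝ φ x) (a : ℝ)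
    (z : E N) :
    gradient (fun y => φ y + a * ‖y - z‖ ^ 2) x = gradient φ x + (2 * a) • (x - z) := by
  apply HasGradientAt.gradient
  rw [hasGradientAt_iff_hasFDerivAt]
  have h1 := hφ.hasGradientAt.hasFDerivAt
  have h2 := ((hasFDerivAt_id (𝕜 := ℝ) x).sub_const z).norm_sq
  refine (h1.add (h2.const_mul a)).congr_fderiv ?_
  ext y
  simp
  ring

lemma contDiff_mul_norm_sub_sq (a : ℝ) (z : E N) :
    ContDiff ℝ 1 (fun y : E N => a * ‖y - z‖ ^ 2) :=
  contDiff_const.mul ((contDiff_id.sub contDiff_const).norm_sq ℝ)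

lemma gradient_mul_norm_sub_sq (a : ℝ) (x z : E N) :
    gradient (fun y : E N => a * ‖y - z‖ ^ 2) x = (2 * a) • (x - z) := by
  have h := gradient_add_mul_norm_sub_sq (φ := fun _ => (0 : ℝ)) (x := x)
    (differentiableAt_const _) a z
  have h0 : gradient (fun _ : E N => (0 : ℝ)) x = 0 := by simp [gradient]
  simpa [h0] using h

lemma continuous_gradient {φ : E N → ℝ} (hφ : ContDiff ℝ 1 φ) : Continuous (gradient φ) :=
  (InnerProductSpace.toDual ℝ (E N)).symm.continuous.comp (hφ.continuous_fderiv one_ne_zero)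

lemma gradient_const_mul {φ : E N → ℝ} {x : E N} (hφ : DifferentiableAt ℝ φ x) (a : ℝ) :
    gradient (fun y => a * φ y) x = a • gradient φ x := by
  simp [gradient, fderiv_const_mul hφ]

lemma gradient_fun_neg (φ : E N → ℝ) (x : E N) :
    gradient (fun y => -φ y) x = -gradient φ x := by
  simp [gradient, fderiv_fun_neg]

lemma gradient_eq_of_isLocalMax_sub {ψ φ : E N → ℝ} {x : E N} (hψ : DifferentiableAt ℝ ψ x)
    (hφ : DifferentiableAt ℝ φ x) (h : IsLocalMax (fun y => ψ y - φ y) x) :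
    gradient ψ x = gradient φ x := by
  have h0 := h.fderiv_eq_zero
  rw [fderiv_fun_sub hψ hφ, sub_eq_zero] at h0
  simp [gradient, h0]

lemma exists_isLocalMax_of_lt_on_sphere {g : E N → ℝ} (hg : Continuous g) {x : E N} {r : ℝ}
    (hr : 0 < r) (h : ∀ y, ‖y - x‖ = r → g y < g x) :
    ∃ y ∈ Metric.ball x r, (∀ z ∈ Metric.closedBall x r, g z ≤ g y) ∧ IsLocalMax g y := by
  obtain ⟨y, hy, hmax⟩ := (isCompact_closedBall x r).exists_isMaxOn
    ⟨x, Metric.mem_closedBall_self hr.le⟩ hg.continuousOn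
  have hyb : y ∈ Metric.ball x r := by
    rw [Metric.mem_ball, dist_eq_norm]
    rw [Metric.mem_closedBall, dist_eq_norm] at hy
    refine lt_of_le_of_ne hy fun he => ?_
    exact absurd (hmax (Metric.mem_closedBall_self hr.le)) (not_le.2 (h y he))
  exact ⟨y, hyb, fun z hz => hmax hz, hmax.isLocalMax
    (mem_of_superset (Metric.isOpen_ball.mem_nhds hyb) Metric.ball_subset_closedBall)⟩

/-! ### Viscosity sub- and supersolutions on a set -/

/-- `v` satisfies the viscosity subsolution test at the points of `Ω`. -/
def IsViscSubOn (Ω : Set (E N)) (H : E N → E N → ℝ) (f v : E N → ℝ) : Prop :=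
  ∀ φ : E N → ℝ, ContDiff ℝ 1 φ → ∀ x ∈ Ω,
    IsLocalMax (fun y => v y - φ y) x → H x (gradient φ x) ≤ f x

/-- `v` satisfies the viscosity supersolution test at the points of `Ω`. -/
def IsViscSuperOn (Ω : Set (E N)) (H : E N → E N → ℝ) (f v : E N → ℝ) : Prop :=
  ∀ φ : E N → ℝ, ContDiff ℝ 1 φ → ∀ x ∈ Ω,
    IsLocalMin (fun y => v y - φ y) x → f x ≤ H x (gradient φ x)

lemma IsViscSub.on {H : E N → E N → ℝ} {f v : E N → ℝ} (h : IsViscSub H f v) (Ω : Set (E N)) :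
    IsViscSubOn Ω H f v := fun φ hφ x _ => h φ hφ x

lemma IsViscSuper.on {H : E N → E N → ℝ} {f v : E N → ℝ} (h : IsViscSuper H f v)
    (Ω : Set (E N)) : IsViscSuperOn Ω H f v := fun φ hφ x _ => h φ hφ x

lemma IsViscSuperOn.neg {Ω : Set (E N)} {H : E N → E N → ℝ} {f v : E N → ℝ}
    (h : IsViscSuperOn Ω H f v) :
    IsViscSubOn Ω (fun x p => -H x (-p)) (fun x => -f x) (fun x => -v x) := by
  intro φ hφ x hx hmax
  have := h (fun y => -φ y) hφ.neg x hx (by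
    have := hmax.neg
    refine this.congr (Eventually.of_forall fun y => ?_)
    ring)
  rw [gradient_fun_neg] at this
  exact neg_le_neg this

lemma IsViscSub.sub_const {H : E N → E N → ℝ} {f v : E N → ℝ} (h : IsViscSub H f v) (a : ℝ) :
    IsViscSub H f (fun x => v x - a) := by
  intro φ hφ x hmax
  refine h φ hφ x ?_
  filter_upwards [hmax] with y hy
  linarith

lemma IsViscSuperOn.sub_const {Ω : Set (E N)} {H : E N → E N → ℝ} {f v : E N → ℝ}
    (h : IsViscSuperOn Ω H f v) (a : ℝ) : IsViscSuperOn Ω H f (fun x => v x - a) := by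
  intro φ hφ x hx hmin
  refine h φ hφ x hx ?_
  filter_upwards [hmin] with y hy
  linarith

/-- Stability of the subsolution test under approximations from within `δ`: `w` has to lie below
`v + δ` near `x`, and above `v - δ` only at `x`. -/
lemma le_of_isLocalMax_of_approx {H : E N → E N → ℝ} {f v φ : E N → ℝ}
    (hH : Continuous (fun z : E N × E N => H z.1 z.2)) (hf : Continuous f)
    (hφ : ContDiff ℝ 1 φ) {x : E N} {r : ℝ} (hr : 0 < r)
    (hmax : IsLocalMax (fun y => v y - φ y) x)
    (happ : ∀ δ > 0, ∃ w : E N → ℝ, Continuous w ∧ IsViscSubOn (Metric.ball x r) H f w ∧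
      (∀ y ∈ Metric.ball x r, w y ≤ v y + δ) ∧ v x - δ ≤ w x) :
    H x (gradient φ x) ≤ f x := by
  by_contra! hlt
  have hcont : Continuous fun y => H y (gradient φ y + (2 * 1 : ℝ) • (y - x)) :=
    have hg := continuous_gradient hφ
    hH.comp (continuous_id.prodMk (by fun_prop :
      Continuous fun y => gradient φ y + (2 * 1 : ℝ) • (y - x)))
  have hev : ∀ᶠ y in 𝓝 x, f y < H y (gradient φ y + (2 * 1 : ℝ) • (y - x)) :=
    hf.continuousAt.eventually_lt hcont.continuousAt (by simpa using hlt)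
  obtain ⟨s, hs, hball⟩ := Metric.eventually_nhds_iff_ball.1
    ((hev.and hmax).and (Metric.ball_mem_nhds x hr))
  set ρ := s / 2
  have hρ : 0 < ρ := by positivity
  have hρs : ρ < s := by simp only [ρ]; linarith
  -- The quadratic term costs `ρ ^ 2` on the sphere, while replacing `v` by `w` costs at most twice
  -- `ρ ^ 2 / 4`, so the maximum stays inside.
  obtain ⟨w, hw, hsub, hup, hlow⟩ := happ (ρ ^ 2 / 4) (by positivity)
  have hψ := contDiff_add_mul_norm_sub_sq hφ 1 x
  obtain ⟨y, hy, -, hloc⟩ := exists_isLocalMax_of_lt_on_sphere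
    (g := fun y => w y - (φ y + 1 * ‖y - x‖ ^ 2)) (hw.sub hψ.continuous) hρ (x := x) (by
      intro y hy
      have hyb : y ∈ Metric.ball x s := by rw [Metric.mem_ball, dist_eq_norm, hy]; exact hρs
      obtain ⟨⟨-, h2⟩, h3⟩ := hball y hyb
      have h4 := hup y h3
      simp only [hy, sub_self, norm_zero]
      dsimp only at h2
      nlinarith [sq_pos_of_pos hρ])
  obtain ⟨⟨h1, -⟩, h3⟩ := hball y (Metric.ball_subset_ball hρs.le hy)
  have h5 := hsub _ hψ y h3 hloc
  rw [gradient_add_mul_norm_sub_sq (hφ.differentiable one_ne_zero y)] at h5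
  exact absurd h5 (not_le.2 h1)

lemma le_of_isLocalMin_of_approx {H : E N → E N → ℝ} {f v φ : E N → ℝ}
    (hH : Continuous (fun z : E N × E N => H z.1 z.2)) (hf : Continuous f)
    (hφ : ContDiff ℝ 1 φ) {x : E N} {r : ℝ} (hr : 0 < r)
    (hmin : IsLocalMin (fun y => v y - φ y) x)
    (happ : ∀ δ > 0, ∃ w : E N → ℝ, Continuous w ∧ IsViscSuperOn (Metric.ball x r) H f w ∧
      ∀ y ∈ Metric.ball x r, |w y - v y| ≤ δ) :
    f x ≤ H x (gradient φ x) := by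
  have hH' : Continuous (fun z : E N × E N => -H z.1 (-z.2)) :=
    (hH.comp (continuous_fst.prodMk continuous_snd.neg)).neg
  have := le_of_isLocalMax_of_approx (H := fun x p => -H x (-p)) (f := fun x => -f x)
    (v := fun x => -v x) (φ := fun x => -φ x) hH' hf.neg hφ.neg hr
    (hmin.neg.congr (Eventually.of_forall fun y => by ring)) (fun δ hδ => by
      obtain ⟨w, hw, hsup, hwv⟩ := happ δ hδ
      refine ⟨fun y => -w y, hw.neg, hsup.neg, fun y hy => ?_, ?_⟩
      · have := (abs_le.1 (hwv y hy)).1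
        linarith
      · have := (abs_le.1 (hwv x (Metric.mem_ball_self hr))).2
        linarith)
  rw [gradient_fun_neg, neg_neg] at this
  linarith

/-! ### Lipschitz estimates -/

/-- Cutting the segment into `n` equal pieces leaves the linear terms unchanged in total, while the
quadratic errors add up to `A d² / n`, which tends to `0`. -/
lemma sub_le_mul_norm_of_quadratic_error {f : E N → ℝ} {s : Set (E N)} (hs : Convex ℝ s)
    {L A ρ : ℝ} (hρ : 0 < ρ)
    (h : ∀ x ∈ s, ∀ y ∈ s, ‖x - y‖ ≤ ρ → f x - f y ≤ L * ‖x - y‖ + A * ‖x - y‖ ^ 2) :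
    ∀ x ∈ s, ∀ y ∈ s, f x - f y ≤ L * ‖x - y‖ := by
  intro x hx y hy
  set d := ‖x - y‖
  have key : ∀ n : ℕ, 1 ≤ n → d / n ≤ ρ → f x - f y ≤ L * d + A * d ^ 2 / n := by
    intro n hn hdn
    have hn0 : (0 : ℝ) < n := by exact_mod_cast hn
    set p : ℕ → E N := fun k => y + ((k : ℝ) / n) • (x - y)
    have hp : ∀ k ≤ n, p k ∈ s := fun k hk => by
      have hk' : (k : ℝ) ≤ n := by exact_mod_cast hk
      exact hs.add_smul_sub_mem hy hx ⟨by positivity, (div_le_one hn0).2 hk'⟩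
    have hstep : ∀ k, ‖p (k + 1) - p k‖ = d / n := by
      intro k
      have : p (k + 1) - p k = (1 / (n : ℝ)) • (x - y) := by
        simp only [p, add_sub_add_left_eq_sub, ← sub_smul]
        congr 1
        push_cast
        field_simp
        ring
      rw [this, norm_smul, Real.norm_of_nonneg (by positivity)]
      ring
    have hind : ∀ k ≤ n, f (p k) - f y ≤ k * (L * (d / n) + A * (d / n) ^ 2) := by
      intro k
      induction k with
      | zero => intro _; simp [p]
      | succ k ih =>
        intro hk
        have h1 := ih (by omega)
        have h2 := h _ (hp (k + 1) hk) _ (hp k (by omega)) (by rw [hstep]; exact hdn)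
        rw [hstep] at h2
        push_cast
        linarith
    have := hind n le_rfl
    have hpn : p n = x := by simp [p, hn0.ne']
    rw [hpn] at this
    calc f x - f y ≤ _ := this
      _ = L * d + A * d ^ 2 / n := by field_simp
  have hlim : Tendsto (fun n : ℕ => L * d + A * d ^ 2 / n) atTop (𝓝 (L * d + 0)) :=
    tendsto_const_nhds.add (tendsto_const_div_atTop_nhds_zero_nat _)
  rw [add_zero] at hlim
  refine ge_of_tendsto hlim ?_
  have h1 : ∀ᶠ n : ℕ in atTop, d / n < ρ :=
    (tendsto_const_div_atTop_nhds_zero_nat d).eventually_lt_const hρ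
  filter_upwards [h1, eventually_ge_atTop 1] with n hn hn1 using key n hn1 hn.le

/-- A continuous viscosity subsolution of `|Dv| = L` on a ball is `L`-Lipschitz on the concentric
ball of radius smaller by one. -/
lemma sub_le_mul_norm_of_isViscSubOn {v : E N → ℝ} (hv : Continuous v) {R L : ℝ} (hL : 0 ≤ L)
    (hsub : IsViscSubOn (Metric.ball 0 (R + 1)) (fun _ p => ‖p‖) (fun _ => L) v) :
    ∀ x ∈ Metric.ball (0 : E N) R, ∀ y ∈ Metric.ball (0 : E N) R, v x - v y ≤ L * ‖x - y‖ := by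
  obtain ⟨M, hM⟩ := (isCompact_closedBall (0 : E N) (R + 1)).exists_bound_of_continuousOn
    hv.continuousOn
  simp only [Real.norm_eq_abs] at hM
  have hsubset : ∀ x ∈ Metric.ball (0 : E N) R, Metric.closedBall x 1 ⊆
      Metric.closedBall 0 (R + 1) := fun x hx =>
    Metric.closedBall_subset_closedBall' (by rw [Metric.mem_ball] at hx; linarith)
  -- Sup-convolution of `v`: the penalty `A > 2M` keeps the maximizer off the unit sphere around
  -- `x`, and the subsolution test there bounds the slope `2A‖y - x‖` by `L`.
  have hpt : ∀ A : ℝ, 2 * M < A → 0 < A → ∀ x ∈ Metric.ball (0 : E N) R,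
      ∃ y, 2 * A * ‖y - x‖ ≤ L ∧
        ∀ z ∈ Metric.closedBall x 1, v z - A * ‖z - x‖ ^ 2 ≤ v y - A * ‖y - x‖ ^ 2 := by
    intro A hA hA0 x hx
    have hψ := contDiff_mul_norm_sub_sq A x
    obtain ⟨y, hy, hmax, hloc⟩ := exists_isLocalMax_of_lt_on_sphere
      (g := fun y => v y - A * ‖y - x‖ ^ 2) (hv.sub hψ.continuous) one_pos (x := x) (by
        intro y hy
        have h1 := (abs_le.1 (hM y (hsubset x hx (by
          rw [Metric.mem_closedBall, dist_eq_norm, hy])))).2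
        have h2 := (abs_le.1 (hM x (hsubset x hx (by simp)))).1
        simp only [hy, sub_self, norm_zero]
        linarith)
    have h := hsub _ hψ y (by
      rw [Metric.mem_ball] at hx hy ⊢
      linarith [dist_triangle y x 0]) hloc
    beta_reduce at h
    rw [gradient_mul_norm_sub_sq, norm_smul, Real.norm_of_nonneg (by positivity)] at h
    exact ⟨y, h, hmax⟩
  have hreg : ∀ A : ℝ, 2 * M < A → 0 < A → L ≤ A → ∀ x ∈ Metric.ball (0 : E N) R,
      ∀ y ∈ Metric.ball (0 : E N) R, ∃ z, 2 * A * ‖z - y‖ ≤ L ∧ v x - v z ≤ L * ‖x - y‖ := by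
    intro A hA hA0 hLA
    choose! q hq1 hq2 using hpt A hA hA0
    -- The competitor `q x` in the problem at `y` gives the quadratic-error estimate. Since `L ≤ A`,
    -- the shift `q x - x` has length at most `1 / 2`, so `q x` lies in the unit ball around `y`.
    have hlip := sub_le_mul_norm_of_quadratic_error
      (f := fun x => v (q x) - A * ‖q x - x‖ ^ 2) (L := L) (A := A) (convex_ball (0 : E N) R)
      (ρ := 1 / 2) (by norm_num) (by
        intro x hx y hy hxy
        have h1 := hq1 x hx
        have hs : ‖q x - x‖ ≤ 1 / 2 := by
          by_contra! hcon
          nlinarith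
        have htri : ‖q x - y‖ ≤ ‖q x - x‖ + ‖x - y‖ := norm_sub_le_norm_sub_add_norm_sub _ _ _
        have h2 := hq2 y hy (q x) (by rw [Metric.mem_closedBall, dist_eq_norm]; linarith)
        have h3 : ‖q x - y‖ ^ 2 ≤ (‖q x - x‖ + ‖x - y‖) ^ 2 := by gcongr
        have h4 := mul_le_mul_of_nonneg_left h3 hA0.le
        have h5 := mul_le_mul_of_nonneg_right h1 (norm_nonneg (x - y))
        nlinarith)
    intro x hx y hy
    refine ⟨q y, hq1 y hy, ?_⟩
    have h1 := hlip x hx y hy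
    have h2 := hq2 x hx x (by simp)
    have h3 : 0 ≤ A * ‖q y - y‖ ^ 2 := by positivity
    simp only [sub_self, norm_zero] at h1 h2
    linarith
  intro x hx y hy
  refine le_of_forall_pos_le_add fun ε hε => ?_
  obtain ⟨δ, hδ, hvδ⟩ := Metric.continuousAt_iff.1 (hv.continuousAt (x := y)) ε hε
  -- The bound `A ≥ L / δ` puts `z` within `δ` of `y`, so continuity replaces `v z` by `v y` at cost
  -- `ε`.
  obtain ⟨z, hz1, hz2⟩ := hreg (max (max (2 * M + 1) (L + 1)) (L / δ))
    (lt_of_lt_of_le (by linarith) ((le_max_left _ _).trans (le_max_left _ _)))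
    (lt_of_lt_of_le (by linarith) ((le_max_right _ _).trans (le_max_left _ _)))
    (le_trans (by linarith) ((le_max_right _ _).trans (le_max_left _ _))) x hx y hy
  set A := max (max (2 * M + 1) (L + 1)) (L / δ)
  have hA1 : L + 1 ≤ A := (le_max_right _ _).trans (le_max_left _ _)
  have hA2 : L ≤ A * δ := (div_le_iff₀ hδ).1 (le_max_right _ _)
  have hzδ : ‖z - y‖ < δ := by
    by_contra! hcon
    have := mul_le_mul_of_nonneg_left hcon (by linarith : 0 ≤ 2 * A)
    have : 0 < A * δ := by apply mul_pos _ hδ; linarith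
    linarith
  have := hvδ (by rwa [dist_eq_norm])
  rw [Real.dist_eq] at this
  linarith [(abs_lt.1 this).2]

/-- All continuous subsolutions are Lipschitz on every ball, with constants common to all. -/
def SubsolutionsEquiLipschitz (H : E N → E N → ℝ) (f : E N → ℝ) : Prop :=
  ∀ R : ℝ, ∃ L : ℝ, 0 ≤ L ∧ ∀ w : E N → ℝ, Continuous w → IsViscSub H f w →
    ∀ x ∈ Metric.ball (0 : E N) R, ∀ y ∈ Metric.ball (0 : E N) R, w x - w y ≤ L * ‖x - y‖

lemma Coercive.subsolutionsEquiLipschitz {H : E N → E N → ℝ} (hH : Coercive H) {f : E N → ℝ}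
    (hf : Continuous f) : SubsolutionsEquiLipschitz H f := by
  obtain ⟨ν, hν, hν0, hνH⟩ := hH
  intro R
  obtain ⟨L, hL⟩ := (isCompact_closedBall (0 : E N) (R + 1)).exists_bound_of_continuousOn
    (hf.div hν fun x => (hν0 x).ne').continuousOn
  refine ⟨max L 0, le_max_right _ _, fun w hw hsub => ?_⟩
  refine sub_le_mul_norm_of_isViscSubOn hw (le_max_right _ _) fun φ hφ x hx hmax => ?_
  have h1 := (hνH x _).trans (hsub φ hφ x hmax)
  have h2 := (le_abs_self _).trans (hL x (Metric.ball_subset_closedBall hx))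
  refine le_trans ?_ (h2.trans (le_max_left _ _))
  rw [Pi.div_apply, le_div_iff₀ (hν0 x)]
  linarith

lemma locallyLipschitz_of_ball {v : E N → ℝ}
    (h : ∀ R : ℝ, ∃ L : ℝ, 0 ≤ L ∧ ∀ x ∈ Metric.ball (0 : E N) R,
      ∀ y ∈ Metric.ball (0 : E N) R, v x - v y ≤ L * ‖x - y‖) : LocallyLipschitz v := by
  intro x
  obtain ⟨L, hL0, hL⟩ := h (‖x‖ + 1)
  refine ⟨⟨L, hL0⟩, Metric.ball 0 (‖x‖ + 1), Metric.isOpen_ball.mem_nhds (by simp), ?_⟩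
  refine LipschitzOnWith.of_dist_le_mul fun y hy z hz => ?_
  rw [Real.dist_eq, dist_eq_norm, abs_le]
  have h1 := hL y hy z hz
  have h2 := hL z hz y hy
  rw [norm_sub_rev] at h2
  constructor
  · change -(L * ‖y - z‖) ≤ _
    linarith
  · exact h1

end ErgodicHJ

namespace ErgodicHJ

variable {N : ℕ}

/-! ### Perron's method -/

lemma isViscSub_zero {H : E N → E N → ℝ} {f : E N → ℝ} (hH0 : ∀ x, H x 0 = 0)
    (hf0 : ∀ x, 0 ≤ f x) : IsViscSub H f fun _ => 0 := by
  intro φ hφ x hmax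
  have h := gradient_eq_of_isLocalMax_sub (ψ := fun _ => (0 : ℝ)) (differentiableAt_const _)
    (hφ.differentiable one_ne_zero x) hmax
  rw [← h]
  simpa [gradient, hH0] using hf0 x

/-- The continuous subsolutions which are nonpositive on `K`. -/
def perronFamily (H : E N → E N → ℝ) (f : E N → ℝ) (K : Set (E N)) : Set (E N → ℝ) :=
  {w | Continuous w ∧ IsViscSub H f w ∧ ∀ x ∈ K, w x ≤ 0}

/-- The upper envelope of the continuous subsolutions which are nonpositive on `K`. -/
noncomputable def perron (H : E N → E N → ℝ) (f : E N → ℝ) (K : Set (E N)) (x : E N) : ℝ :=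
  sSup ((fun w => w x) '' perronFamily H f K)

section Perron

variable {H : E N → E N → ℝ} {f : E N → ℝ} {K : Set (E N)}

lemma bddAbove_perronFamily (hE : SubsolutionsEquiLipschitz H f) (hK : K.Nonempty) (x : E N) :
    BddAbove ((fun w => w x) '' perronFamily H f K) := by
  obtain ⟨k, hk⟩ := hK
  obtain ⟨L, -, hL⟩ := hE (max ‖x‖ ‖k‖ + 1)
  refine ⟨L * ‖x - k‖, ?_⟩
  rintro _ ⟨w, ⟨hw, hsub, hwK⟩, rfl⟩
  have h := hL w hw hsub x
    (by rw [mem_ball_zero_iff]; linarith [le_max_left ‖x‖ ‖k‖]) k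
    (by rw [mem_ball_zero_iff]; linarith [le_max_right ‖x‖ ‖k‖])
  have := hwK k hk
  dsimp only
  linarith

lemma le_perron (hE : SubsolutionsEquiLipschitz H f) (hK : K.Nonempty) {w : E N → ℝ}
    (hw : w ∈ perronFamily H f K) (x : E N) : w x ≤ perron H f K x :=
  le_csSup (bddAbove_perronFamily hE hK x) ⟨w, hw, rfl⟩

lemma exists_lt_of_lt_perron (hne : (perronFamily H f K).Nonempty) {x : E N} {a : ℝ}
    (ha : a < perron H f K x) : ∃ w ∈ perronFamily H f K, a < w x := by
  obtain ⟨_, ⟨w, hw, rfl⟩, h⟩ := exists_lt_of_lt_csSup (hne.image _) ha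
  exact ⟨w, hw, h⟩

lemma perron_nonpos (hne : (perronFamily H f K).Nonempty) {x : E N} (hx : x ∈ K) :
    perron H f K x ≤ 0 := by
  refine csSup_le (hne.image _) ?_
  rintro _ ⟨w, hw, rfl⟩
  exact hw.2.2 x hx

lemma locallyLipschitz_perron (hE : SubsolutionsEquiLipschitz H f) (hK : K.Nonempty)
    (hne : (perronFamily H f K).Nonempty) : LocallyLipschitz (perron H f K) := by
  refine locallyLipschitz_of_ball fun R => ?_
  obtain ⟨L, hL0, hL⟩ := hE R
  refine ⟨L, hL0, fun x hx y hy => ?_⟩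
  rw [sub_le_iff_le_add]
  refine csSup_le (hne.image _) ?_
  rintro _ ⟨w, hw, rfl⟩
  have h1 := hL w hw.1 hw.2.1 x hx y hy
  have h2 := le_perron hE hK hw y
  dsimp only
  linarith

lemma isViscSub_perron (hH : Continuous (fun z : E N × E N => H z.1 z.2)) (hf : Continuous f)
    (hE : SubsolutionsEquiLipschitz H f) (hK : K.Nonempty)
    (hne : (perronFamily H f K).Nonempty) : IsViscSub H f (perron H f K) := by
  intro φ hφ x hmax
  refine le_of_isLocalMax_of_approx hH hf hφ one_pos hmax fun δ hδ => ?_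
  -- One member nearly optimal at `x` is enough: stability asks for the lower bound at `x` only.
  obtain ⟨w, hw, hlt⟩ := exists_lt_of_lt_perron hne (sub_lt_self (perron H f K x) hδ)
  exact ⟨w, hw.1, hw.2.1.on _, fun y _ => (le_perron hE hK hw y).trans (by linarith), hlt.le⟩

/-- A subsolution that fails the supersolution test at `x₀` can be raised there, with changes only
in a prescribed neighbourhood of `x₀`. -/
lemma exists_isViscSub_gt {v φ : E N → ℝ} (hH : Continuous (fun z : E N × E N => H z.1 z.2))
    (hf : Continuous f) (hv : Continuous v) (hsub : IsViscSub H f v) (hφ : ContDiff ℝ 1 φ)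
    {x₀ : E N} (hmin : IsLocalMin (fun y => v y - φ y) x₀) (hlt : H x₀ (gradient φ x₀) < f x₀)
    {U : Set (E N)} (hU : U ∈ 𝓝 x₀) :
    ∃ w, Continuous w ∧ IsViscSub H f w ∧ (∀ x ∉ U, w x = v x) ∧ v x₀ < w x₀ := by
  have hg := continuous_gradient hφ
  have hcont : Continuous fun y => H y (gradient φ y + (2 * (-1) : ℝ) • (y - x₀)) :=
    hH.comp (continuous_id.prodMk (by fun_prop :
      Continuous fun y => gradient φ y + (2 * (-1) : ℝ) • (y - x₀)))
  have hev : ∀ᶠ y in 𝓝 x₀, H y (gradient φ y + (2 * (-1) : ℝ) • (y - x₀)) < f y :=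
    hcont.continuousAt.eventually_lt hf.continuousAt (by simpa using hlt)
  obtain ⟨r, hr, hball⟩ := Metric.eventually_nhds_iff_ball.1 ((hev.and hmin).and hU)
  -- The bump `ψ + a` exceeds `v` by `r ^ 2 / 8` at `x₀`, but is below `v` once `‖y - x₀‖ > r / 2`,
  -- where the quadratic term has taken away more than `r ^ 2 / 4`. Hence the maximum glues
  -- continuously to `v`.
  set a := v x₀ - φ x₀ + r ^ 2 / 8
  set ψ : E N → ℝ := fun y => φ y + (-1) * ‖y - x₀‖ ^ 2
  have hψ : ContDiff ℝ 1 ψ := contDiff_add_mul_norm_sub_sq hφ (-1) x₀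
  have hψv : ∀ y ∈ Metric.ball x₀ r, r / 2 < ‖y - x₀‖ → ψ y + a < v y := by
    intro y hy hyr
    have h := (hball y hy).1.2
    dsimp only at h
    have : (r / 2) ^ 2 < ‖y - x₀‖ ^ 2 := by gcongr
    simp only [ψ, a]
    nlinarith
  classical
  set w : E N → ℝ := fun y => if y ∈ Metric.ball x₀ r then max (v y) (ψ y + a) else v y
  have hin : ∀ y ∈ Metric.ball x₀ r, w y = max (v y) (ψ y + a) := fun y hy => if_pos hy
  have hout : ∀ y, r / 2 < ‖y - x₀‖ → w y = v y := by
    intro y hy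
    by_cases hyb : y ∈ Metric.ball x₀ r
    · rw [hin y hyb, max_eq_left (hψv y hyb hy).le]
    · exact if_neg hyb
  have hopen : IsOpen {y : E N | r / 2 < ‖y - x₀‖} :=
    isOpen_lt continuous_const (continuous_id.sub continuous_const).norm
  have hnear : ∀ y, y ∈ Metric.ball x₀ r ∨ r / 2 < ‖y - x₀‖ := by
    intro y
    rw [Metric.mem_ball, dist_eq_norm]
    by_contra! h
    linarith
  refine ⟨w, ?_, ?_, fun x hx => if_neg fun hxb => hx (hball x hxb).2, ?_⟩
  · rw [continuous_iff_continuousAt]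
    intro y
    rcases hnear y with hy | hy
    · exact (hv.max (hψ.continuous.add continuous_const)).continuousAt.congr
        (mem_of_superset (Metric.isOpen_ball.mem_nhds hy) fun z hz => (hin z hz).symm)
    · exact hv.continuousAt.congr (mem_of_superset (hopen.mem_nhds hy) fun z hz => (hout z hz).symm)
  · intro χ hχ y hmax
    have hvw : ∀ z, v z ≤ w z := fun z => by
      by_cases hz : z ∈ Metric.ball x₀ r
      · rw [hin z hz]; exact le_max_left _ _
      · exact (if_neg hz).ge
    -- Where `w = v`, a test function for `w` also tests `v`; elsewhere `w` is locally bounded below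
    -- by the smooth bump with equality at `y`, so the test gradient is that of `ψ`, where `H < f`.
    by_cases hwy : w y = v y
    · refine hsub χ hχ y ?_
      filter_upwards [hmax] with z hz
      linarith [hvw z]
    · have hy : y ∈ Metric.ball x₀ r := (hnear y).resolve_right fun h => hwy (hout y h)
      have hwψ : w y = ψ y + a := by
        rw [hin y hy] at hwy ⊢
        exact (max_choice _ _).resolve_left hwy
      have hmaxψ : IsLocalMax (fun z => ψ z - χ z) y := by
        filter_upwards [hmax, Metric.isOpen_ball.mem_nhds hy] with z hz hzb
        have h1 := hin z hzb ▸ le_max_right (v z) (ψ z + a)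
        linarith
      rw [← gradient_eq_of_isLocalMax_sub (hψ.differentiable one_ne_zero y)
        (hχ.differentiable one_ne_zero y) hmaxψ,
        gradient_add_mul_norm_sub_sq (hφ.differentiable one_ne_zero y)]
      exact (hball y hy).1.1.le
  · rw [hin x₀ (Metric.mem_ball_self hr)]
    refine lt_max_of_lt_right ?_
    simp only [ψ, a, sub_self, norm_zero]
    nlinarith

/-- If the test failed off `K`, raising the envelope inside the open set `Kᶜ` would give a larger
member of the family. -/
lemma isViscSuperOn_perron (hH : Continuous (fun z : E N × E N => H z.1 z.2))
    (hf : Continuous f) (hE : SubsolutionsEquiLipschitz H f) (hK : K.Nonempty)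
    (hKc : IsClosed K) (hne : (perronFamily H f K).Nonempty) :
    IsViscSuperOn Kᶜ H f (perron H f K) := by
  intro φ hφ x hx hmin
  by_contra! hlt
  obtain ⟨w, hw, hwsub, hwK, hgt⟩ := exists_isViscSub_gt hH hf
    (locallyLipschitz_perron hE hK hne).continuous (isViscSub_perron hH hf hE hK hne) hφ hmin hlt
    (hKc.isOpen_compl.mem_nhds hx)
  refine absurd (le_perron hE hK ⟨hw, hwsub, fun y hy => ?_⟩ x) (not_le.2 hgt)
  rw [hwK y (not_not.2 hy)]
  exact perron_nonpos hne hy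

end Perron

/-! ### Locally uniform limits -/

/-- Limits are taken along a nonprincipal ultrafilter, which replaces the diagonal subsequence of
Arzelà–Ascoli. Equi-Lipschitz bounds make the convergence uniform on unit balls, and viscosity tests
are stable under it. -/
lemma exists_solution_of_seq {H : E N → E N → ℝ} {f : E N → ℝ}
    (hH : Continuous (fun z : E N × E N => H z.1 z.2)) (hf : Continuous f)
    (hE : SubsolutionsEquiLipschitz H f) {v : ℕ → E N → ℝ} (hv : ∀ n, Continuous (v n))
    (hsub : ∀ n, IsViscSub H f (v n))
    (hsuper : ∀ R, ∀ᶠ n in atTop, IsViscSuperOn (Metric.ball 0 R) H f (v n))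
    (h0 : ∀ n, v n 0 = 0) :
    ∃ u : E N → ℝ, LocallyLipschitz u ∧ IsViscSub H f u ∧ IsViscSuper H f u := by
  have hlim : ∀ x, ∃ a, Tendsto (fun n => v n x) (hyperfilter ℕ) (𝓝 a) := by
    intro x
    obtain ⟨L, -, hL⟩ := hE (‖x‖ + 1)
    have hx : x ∈ Metric.ball (0 : E N) (‖x‖ + 1) := by simp
    have h0' : (0 : E N) ∈ Metric.ball (0 : E N) (‖x‖ + 1) := by
      simp only [Metric.mem_ball, dist_self]; positivity
    have hmem : ∀ n, v n x ∈ Icc (-(L * ‖x‖)) (L * ‖x‖) := by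
      intro n
      have h1 := hL _ (hv n) (hsub n) x hx 0 h0'
      have h2 := hL _ (hv n) (hsub n) 0 h0' x hx
      rw [h0, sub_zero, sub_zero] at h1
      rw [h0, zero_sub, zero_sub, norm_neg] at h2
      exact ⟨by linarith, h1⟩
    obtain ⟨a, -, ha⟩ := isCompact_Icc.ultrafilter_le_nhds ((hyperfilter ℕ).map fun n => v n x)
      (le_principal_iff.2 (Filter.mem_map.2 (univ_mem' hmem)))
    exact ⟨a, ha⟩
  choose u hu using hlim
  have hLip : ∀ R : ℝ, ∃ L : ℝ, 0 ≤ L ∧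
      (∀ n, ∀ x ∈ Metric.ball (0 : E N) R, ∀ y ∈ Metric.ball (0 : E N) R,
        v n x - v n y ≤ L * ‖x - y‖) ∧
      ∀ x ∈ Metric.ball (0 : E N) R, ∀ y ∈ Metric.ball (0 : E N) R,
        u x - u y ≤ L * ‖x - y‖ := by
    intro R
    obtain ⟨L, hL0, hL⟩ := hE R
    exact ⟨L, hL0, fun n => hL _ (hv n) (hsub n), fun x hx y hy =>
      le_of_tendsto' ((hu x).sub (hu y)) fun n => hL _ (hv n) (hsub n) x hx y hy⟩
  have hunif : ∀ x, ∀ δ > 0, ∀ᶠ n in (hyperfilter ℕ : Filter ℕ),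
      ∀ y ∈ Metric.ball x 1, |v n y - u y| ≤ δ := by
    intro x δ hδ
    obtain ⟨L, hL0, hLv, hLu⟩ := hLip (‖x‖ + 2)
    have hsubset : Metric.closedBall x 1 ⊆ Metric.ball 0 (‖x‖ + 2) :=
      Metric.closedBall_subset_ball' (by rw [dist_zero_right]; linarith)
    obtain ⟨t, hts, htf, hcov⟩ := (isCompact_closedBall x 1).finite_cover_balls
      (e := δ / (3 * (L + 1))) (by positivity)
    have hev : ∀ᶠ n in (hyperfilter ℕ : Filter ℕ), ∀ z ∈ t, |v n z - u z| < δ / 3 :=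
      (eventually_all_finite htf).2 fun z _ => by
        have := Metric.tendsto_nhds.1 (hu z) (δ / 3) (by positivity)
        simpa only [Real.dist_eq] using this
    filter_upwards [hev] with n hn y hy
    have hyc := Metric.ball_subset_closedBall hy
    obtain ⟨z, hzt, hz⟩ := mem_iUnion₂.1 (hcov hyc)
    rw [Metric.mem_ball, dist_eq_norm, lt_div_iff₀ (by positivity)] at hz
    have hyz : L * ‖y - z‖ ≤ δ / 3 := by nlinarith [norm_nonneg (y - z)]
    have hzy : L * ‖z - y‖ ≤ δ / 3 := by rwa [norm_sub_rev]
    have hy' := hsubset hyc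
    have hz' := hsubset (hts hzt)
    have h1 := hLv n y hy' z hz'
    have h2 := hLv n z hz' y hy'
    have h3 := hLu y hy' z hz'
    have h4 := hLu z hz' y hy'
    have h5 := abs_lt.1 (hn z hzt)
    rw [abs_le]
    constructor <;> linarith [h5.1, h5.2]
  refine ⟨u, locallyLipschitz_of_ball fun R => ?_, fun φ hφ x hmax => ?_, fun φ hφ x hmin => ?_⟩
  · obtain ⟨L, hL0, -, hL⟩ := hLip R
    exact ⟨L, hL0, hL⟩
  · refine le_of_isLocalMax_of_approx hH hf hφ one_pos hmax fun δ hδ => ?_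
    obtain ⟨n, hn⟩ := (hunif x δ hδ).exists
    refine ⟨v n, hv n, (hsub n).on _, fun y hy => ?_, ?_⟩
    · linarith [(abs_le.1 (hn y hy)).2]
    · linarith [(abs_le.1 (hn x (Metric.mem_ball_self one_pos))).1]
  · refine le_of_isLocalMin_of_approx hH hf hφ one_pos hmin fun δ hδ => ?_
    obtain ⟨n, hn, hs⟩ := ((hunif x δ hδ).and
      (Nat.hyperfilter_le_atTop (hsuper (‖x‖ + 1)))).exists
    exact ⟨v n, hv n, fun χ hχ y hy => hs χ hχ y
      (Metric.ball_subset_ball' (by rw [dist_zero_right]; linarith) hy), hn⟩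

/-! ### Existence of solutions -/

lemma exists_isErgodicSolution (hN : 1 ≤ N) {H : E N → E N → ℝ} {l : E N → ℝ}
    (hl : Continuous l) (hl0 : ∀ x, 0 ≤ l x)
    (hH : Continuous (fun z : E N × E N => H z.1 z.2)) (hcoer : Coercive H)
    (hH0 : ∀ x, H x 0 = 0) {c : ℝ} (hc : 0 ≤ c) :
    ∃ v : E N → ℝ, LocallyLipschitz v ∧ IsErgodicSolution H l c v := by
  set f : E N → ℝ := fun x => l x + c
  have hf : Continuous f := hl.add continuous_const
  have hE := hcoer.subsolutionsEquiLipschitz hf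
  -- `1 ≤ N` provides a direction in which the exceptional point escapes to infinity.
  set y : ℕ → E N := fun n => EuclideanSpace.single ⟨0, hN⟩ (n : ℝ)
  have hy : ∀ n, ‖y n‖ = n := fun n => by simp [y]
  have hne : ∀ n, (perronFamily H f {y n}).Nonempty := fun n =>
    ⟨fun _ => 0, continuous_const, isViscSub_zero hH0 fun x => add_nonneg (hl0 x) hc,
      fun _ _ => le_rfl⟩
  have hK : ∀ n, ({y n} : Set (E N)).Nonempty := fun n => singleton_nonempty _
  obtain ⟨u, hu, hsub, hsuper⟩ := exists_solution_of_seq hH hf hE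
    (v := fun n x => perron H f {y n} x - perron H f {y n} 0)
    (fun n => (locallyLipschitz_perron hE (hK n) (hne n)).continuous.sub continuous_const)
    (fun n => (isViscSub_perron hH hf hE (hK n) (hne n)).sub_const _)
    (fun R => by
      filter_upwards [eventually_ge_atTop ⌈R⌉₊] with n hn φ hφ x hx hmin
      refine (isViscSuperOn_perron hH hf hE (hK n) isClosed_singleton (hne n)).sub_const _ φ hφ x
        (fun hxy => ?_) hmin
      rw [mem_singleton_iff] at hxy
      rw [mem_ball_zero_iff, hxy, hy] at hx
      exact absurd (Nat.ceil_le.1 hn) (not_le.2 hx))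
    (fun n => sub_self _)
  exact ⟨u, hu, hc, hu.continuous, hsub, hsuper⟩

lemma exists_nonneg_isErgodicSolution {H : E N → E N → ℝ} {l : E N → ℝ}
    (hl : Continuous l) (hl0 : ∀ x, 0 ≤ l x)
    (hH : Continuous (fun z : E N × E N => H z.1 z.2)) (hA : (argminSet l).Nonempty)
    (hcoer : Coercive H) (hmin0 : StrictlyMinimalAtZero H) :
    ∃ v : E N → ℝ, LocallyLipschitz v ∧ IsErgodicSolution H l 0 v ∧ ∀ x, 0 ≤ v x := by
  set f : E N → ℝ := fun x => l x + 0
  have hf : Continuous f := hl.add continuous_const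
  have hE := hcoer.subsolutionsEquiLipschitz hf
  have hz : (fun _ => 0) ∈ perronFamily H f (argminSet l) :=
    ⟨continuous_const, isViscSub_zero (fun x => (hmin0 x).1) fun x => by simpa [f] using hl0 x,
      fun _ _ => le_rfl⟩
  have hAc : IsClosed (argminSet l) := isClosed_eq hl continuous_const
  have hLip := locallyLipschitz_perron hE hA ⟨_, hz⟩
  refine ⟨_, hLip, ⟨le_rfl, hLip.continuous, isViscSub_perron hH hf hE hA ⟨_, hz⟩, ?_⟩,
    le_perron hE hA hz⟩
  intro φ hφ x hx
  by_cases hxA : x ∈ argminSet l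
  · have hlx : l x = 0 := hxA
    beta_reduce
    rw [hlx, add_zero]
    by_cases hp : gradient φ x = 0
    · rw [hp, (hmin0 x).1]
    · exact ((hmin0 x).2 _ hp).le
  · exact isViscSuperOn_perron hH hf hE hA hAc ⟨_, hz⟩ φ hφ x hxA hx

end ErgodicHJ

namespace ErgodicHJ

variable {N : ℕ}

/-! ### Growth of supersolutions -/

/-- Otherwise a downward paraboloid centred at `x` touches `v` from below inside the ball, up to a
constant, with slope at most `ρ / 2`. -/
lemma add_le_of_isViscSuperOn {v : E N → ℝ} (hv : Continuous v) {ρ b r : ℝ} (hρ : 0 < ρ)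
    (hr : 0 < r) {x : E N}
    (hsuper : IsViscSuperOn (Metric.ball x r) (fun _ p => ‖p‖) (fun _ => ρ) v)
    (hb : ∀ y ∈ Metric.closedBall x r, b ≤ v y) : b + ρ * r / 4 ≤ v x := by
  by_contra! hlt
  set a := -(ρ / (4 * r))
  have har : a * r ^ 2 = -(ρ * r / 4) := by simp only [a]; field_simp
  have hψ := contDiff_mul_norm_sub_sq a x
  obtain ⟨y, hy, -, hloc⟩ := exists_isLocalMax_of_lt_on_sphere
    (g := fun y => -(v y - a * ‖y - x‖ ^ 2)) (hv.sub hψ.continuous).neg hr (x := x) (by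
      intro y hy
      have := hb y (by rw [Metric.mem_closedBall, dist_eq_norm, hy])
      simp only [hy, sub_self, norm_zero]
      linarith)
  have hmin : IsLocalMin (fun y => v y - a * ‖y - x‖ ^ 2) y := by
    filter_upwards [hloc] with z hz using neg_le_neg_iff.1 hz
  have h := hsuper _ hψ y hy hmin
  beta_reduce at h
  rw [gradient_mul_norm_sub_sq, norm_smul] at h
  have h2 : ‖2 * a‖ = ρ / (2 * r) := by
    have : 2 * a = -(ρ / (2 * r)) := by simp only [a]; ring
    rw [this, norm_neg, Real.norm_of_nonneg (by positivity)]
  rw [h2] at h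
  rw [Metric.mem_ball, dist_eq_norm] at hy
  have h3 : ρ / (2 * r) * ‖y - x‖ ≤ ρ / (2 * r) * r := by gcongr
  have h4 : ρ / (2 * r) * r = ρ / 2 := by field_simp
  linarith

lemma GrowthBound.exists_le_norm {H : E N → E N → ℝ} (hG : GrowthBound H) {δ : ℝ} (hδ : 0 < δ) :
    ∃ ρ > 0, ∀ x p, δ ≤ H x p → ρ ≤ ‖p‖ := by
  obtain ⟨m, hm, -, hm0, hmH⟩ := hG
  have hcont : Continuous fun s => (m s : ℝ) := NNReal.continuous_coe.comp hm
  obtain ⟨ρ, hρ, h⟩ := Metric.eventually_nhds_iff.1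
    ((hcont.tendsto 0).eventually_lt_const (by simpa [hm0] using hδ))
  refine ⟨ρ, hρ, fun x p hp => ?_⟩
  by_contra! hcon
  have h1 := h (y := ‖p‖₊) (by simpa [NNReal.dist_eq] using hcon)
  linarith [hmH x p]

lemma tendsto_atTop_of_compactnessCondition {H : E N → E N → ℝ} {l v : E N → ℝ}
    (hG : GrowthBound H) (hC : CompactnessCondition l) (hv : IsErgodicSolution H l 0 v)
    (hv0 : ∀ x, 0 ≤ v x) : Tendsto v (Bornology.cobounded (E N)) atTop := by
  obtain ⟨δ, hδ0, hδ⟩ := EReal.lt_iff_exists_real_btwn.1 hC.2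
  obtain ⟨R, -, hR⟩ := hasBasis_cobounded_norm.eventually_iff.1 (eventually_lt_of_lt_liminf hδ)
  obtain ⟨ρ, hρ, hρH⟩ := hG.exists_le_norm (EReal.coe_pos.1 hδ0)
  have hlim : Tendsto (fun x : E N => ρ / 4 * (‖x‖ - R)) (Bornology.cobounded (E N)) atTop :=
    (tendsto_atTop_add_const_right _ (-R) tendsto_norm_cobounded_atTop).const_mul_atTop
      (by positivity)
  refine tendsto_atTop_mono' _ ?_ hlim
  filter_upwards [tendsto_norm_cobounded_atTop.eventually_gt_atTop R] with x hx
  -- The ball of radius `‖x‖ - R` around `x` stays in the region where `l > δ`, which gives linear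
  -- growth.
  have h := add_le_of_isViscSuperOn hv.continuous hρ (sub_pos.2 hx) (x := x) (b := 0)
    (fun φ hφ y hy hmin => hρH y _ (by
      have hyR : R ≤ ‖y‖ := by
        rw [Metric.mem_ball, dist_eq_norm] at hy
        have := norm_sub_norm_le x y
        rw [norm_sub_rev] at this
        linarith
      have h1 := hv.super φ hφ y hmin
      have h2 : δ < l y := EReal.coe_lt_coe_iff.1 (hR hyR)
      beta_reduce at h1
      linarith)) fun y _ => hv0 y
  linarith

lemma not_bddBelow_range {H : E N → E N → ℝ} {l v : E N → ℝ} {c : ℝ} (hl0 : ∀ x, 0 ≤ l x)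
    (hG : GrowthBound H) (hc : 0 < c) (hv : IsErgodicSolution H l c v) :
    ¬ BddBelow (range v) := by
  rintro ⟨b, hb⟩
  have hbv : ∀ x, b ≤ v x := fun x => hb (mem_range_self x)
  obtain ⟨ρ, hρ, hρH⟩ := hG.exists_le_norm hc
  -- With this radius the estimate would give `v 0 ≥ v 0 + 1`.
  have hr : 0 < 4 * (v 0 - b + 1) / ρ := div_pos (by linarith [hbv 0]) hρ
  have h := add_le_of_isViscSuperOn hv.continuous hρ hr (x := 0) (b := b)
    (fun φ hφ y _ hmin => hρH y _ (le_trans (by linarith [hl0 y]) (hv.super φ hφ y hmin)))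
    fun y _ => hbv y
  have : ρ * (4 * (v 0 - b + 1) / ρ) / 4 = v 0 - b + 1 := by field_simp
  linarith

/-! ### Uniqueness of the ergodic constant -/

section Cauchy

variable {φ : E N × ℝ → ℝ} {x : E N} {t : ℝ}

lemma contDiff_slice (hφ : ContDiffOn ℝ 1 φ (univ ×ˢ Ioi 0)) (ht : 0 < t) :
    ContDiff ℝ 1 fun y => φ (y, t) := by
  rw [← contDiffOn_univ]
  have hmaps : MapsTo (fun y : E N => (y, t)) univ (univ ×ˢ Ioi 0) := fun y _ => ⟨mem_univ y, ht⟩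
  exact hφ.comp (contDiff_id.prodMk contDiff_const).contDiffOn hmaps

lemma differentiableAt_time (hφ : ContDiffOn ℝ 1 φ (univ ×ˢ Ioi 0)) (ht : 0 < t) :
    DifferentiableAt ℝ (fun s => φ (x, s)) t := by
  have h1 : DifferentiableAt ℝ φ (x, t) :=
    (hφ.contDiffAt ((isOpen_univ.prod isOpen_Ioi).mem_nhds
      (mk_mem_prod (mem_univ x) (mem_Ioi.2 ht)))).differentiableAt one_ne_zero
  exact h1.comp t ((differentiableAt_const x).prodMk differentiableAt_id)

lemma deriv_time_eq (hφ : ContDiffOn ℝ 1 φ (univ ×ˢ Ioi 0)) (ht : 0 < t) {a c : ℝ}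
    (h : IsLocalExtr (fun s => a - c * s - φ (x, s)) t) : deriv (fun s => φ (x, s)) t = -c := by
  have hd : HasDerivAt (fun s => a - c * s - φ (x, s))
      (0 - c * 1 - deriv (fun s => φ (x, s)) t) t :=
    ((hasDerivAt_const t a).sub ((hasDerivAt_id t).const_mul c)).sub
      (differentiableAt_time hφ ht).hasDerivAt
  linarith [h.hasDerivAt_eq_zero hd]

end Cauchy

/-- The time slice of the test is differentiable and forces `φ_t = -c`; the space slice at time `t`
is a test function for `v`. -/
lemma IsViscSub.isCauchySub {H : E N → E N → ℝ} {l v : E N → ℝ} {c : ℝ}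
    (hv : IsViscSub H (fun x => l x + c) v) (M : ℝ) :
    IsCauchySub H l fun z => v z.1 - M - c * z.2 := by
  intro φ hφ x t ht hmax
  have hs : IsLocalMax (fun s => v x - M - c * s - φ (x, s)) t :=
    ((by fun_prop : Continuous fun s : ℝ => (x, s)).tendsto t).eventually hmax
  have hy : ∀ᶠ y in 𝓝 x, v y - M - c * t - φ (y, t) ≤ v x - M - c * t - φ (x, t) :=
    ((by fun_prop : Continuous fun y : E N => (y, t)).tendsto x).eventually hmax
  rw [deriv_time_eq hφ ht (Or.inr hs)]
  have := hv _ (contDiff_slice hφ ht) x (by filter_upwards [hy] with y hy; linarith)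
  linarith

lemma IsViscSuper.isCauchySuper {H : E N → E N → ℝ} {l v : E N → ℝ} {c : ℝ}
    (hv : IsViscSuper H (fun x => l x + c) v) :
    IsCauchySuper H l fun z => v z.1 - c * z.2 := by
  intro φ hφ x t ht hmin
  have hs : IsLocalMin (fun s => v x - c * s - φ (x, s)) t :=
    ((by fun_prop : Continuous fun s : ℝ => (x, s)).tendsto t).eventually hmin
  have hy : ∀ᶠ y in 𝓝 x, v x - c * t - φ (x, t) ≤ v y - c * t - φ (y, t) :=
    ((by fun_prop : Continuous fun y : E N => (y, t)).tendsto x).eventually hmin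
  rw [deriv_time_eq hφ ht (Or.inl hs)]
  have := hv _ (contDiff_slice hφ ht) x (by filter_upwards [hy] with y hy; linarith)
  beta_reduce at this
  linarith

lemma ComparisonPrinciple.constant_le {H : E N → E N → ℝ} {l v w : E N → ℝ} {c d M : ℝ}
    (hcp : ComparisonPrinciple H l) (hv : IsErgodicSolution H l c v)
    (hw : IsErgodicSolution H l d w) (hM : ∀ x, |v x - w x| ≤ M) : d ≤ c := by
  have hcv := hv.continuous
  have hcw := hw.continuous
  have key : ∀ t : ℝ, 0 ≤ t → (d - c) * t ≤ 2 * M := by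
    intro t ht
    have h := hcp (fun z => v z.1 - M - c * z.2) (fun z => w z.1 - d * z.2)
      (by fun_prop) (by fun_prop) (hv.sub.isCauchySub M) hw.super.isCauchySuper
      (fun x => by
        have := (abs_le.1 (hM x)).2
        dsimp only
        linarith) 0 t ht
    have := (abs_le.1 (hM 0)).1
    dsimp only at h
    linarith
  by_contra! hlt
  have hM0 : 0 ≤ M := (abs_nonneg _).trans (hM 0)
  have hdc : 0 < d - c := sub_pos.2 hlt
  have h := key ((2 * M + 1) / (d - c)) (by positivity)
  rw [mul_div_cancel₀ _ hdc.ne'] at h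
  linarith

/-! ### Uniqueness of solutions for a given positive constant -/

/-- Doubling of variables on a ball: the difference of a Lipschitz strict subsolution and a
supersolution does not attain its maximum only inside the ball. -/
lemma exists_sphere_sub_le {H : E N → E N → ℝ} {f g u w : E N → ℝ}
    (hH : Continuous (fun z : E N × E N => H z.1 z.2)) (hf : Continuous f) (hg : Continuous g)
    (hfg : ∀ x, f x < g x) (hu : Continuous u) (hw : Continuous w) {R L : ℝ} (hL0 : 0 ≤ L)
    (hL : ∀ x ∈ Metric.closedBall (0 : E N) R, ∀ y ∈ Metric.closedBall (0 : E N) R,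
      u x - u y ≤ L * ‖x - y‖)
    (hsub : IsViscSubOn (Metric.ball 0 R) H f u) (hsuper : IsViscSuperOn (Metric.ball 0 R) H g w)
    {z : E N} (hz : z ∈ Metric.closedBall 0 R) : ∃ b, ‖b‖ = R ∧ u z - w z ≤ u b - w b := by
  by_contra! hcon
  set K := Metric.closedBall (0 : E N) R
  have hK : IsCompact K := isCompact_closedBall _ _
  have hmax : ∀ n : ℕ, ∃ q ∈ K ×ˢ K, ∀ q' ∈ K ×ˢ K,
      u q'.1 - w q'.2 - n * ‖q'.1 - q'.2‖ ^ 2 ≤ u q.1 - w q.2 - n * ‖q.1 - q.2‖ ^ 2 := fun n =>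
    (hK.prod hK).exists_isMaxOn (f := fun q => u q.1 - w q.2 - n * ‖q.1 - q.2‖ ^ 2)
      ⟨(z, z), hz, hz⟩ (by fun_prop)
  choose q hq hqmax using hmax
  -- The common gradient of the penalty in both tests. Comparing with the pair `(y, y)` and using
  -- that `u` is Lipschitz bounds it by `2L`, so a subsequence converges and mere continuity of `H`
  -- suffices.
  set p : ℕ → E N := fun n => (2 * n : ℝ) • ((q n).1 - (q n).2)
  have hnorm : ∀ n : ℕ, n * ‖(q n).1 - (q n).2‖ ≤ L := by
    intro n
    have h1 := hqmax n ((q n).2, (q n).2) ⟨(hq n).2, (hq n).2⟩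
    have h2 := hL _ (hq n).1 _ (hq n).2
    simp only [sub_self, norm_zero] at h1
    rcases (norm_nonneg ((q n).1 - (q n).2)).eq_or_lt with h0 | h0
    · rw [← h0]; simpa using hL0
    · refine le_of_mul_le_mul_right ?_ h0
      nlinarith
  have hp : ∀ n, p n ∈ Metric.closedBall (0 : E N) (2 * L) := by
    intro n
    rw [mem_closedBall_zero_iff, norm_smul, Real.norm_of_nonneg (by positivity)]
    linarith [hnorm n]
  obtain ⟨⟨⟨a, b⟩, p₀⟩, ⟨⟨haK, hbK⟩, -⟩, σ, hσ, hlim⟩ :=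
    ((hK.prod hK).prod (isCompact_closedBall (0 : E N) (2 * L))).tendsto_subseq
      (x := fun n => (q n, p n)) fun n => ⟨hq n, hp n⟩
  have hla : Tendsto (fun n => (q (σ n)).1) atTop (𝓝 a) := hlim.fst_nhds.fst_nhds
  have hlb : Tendsto (fun n => (q (σ n)).2) atTop (𝓝 b) := hlim.fst_nhds.snd_nhds
  have hlp : Tendsto (fun n => p (σ n)) atTop (𝓝 p₀) := hlim.snd_nhds
  obtain rfl : a = b := by
    have h1 : Tendsto (fun n => ‖(q (σ n)).1 - (q (σ n)).2‖) atTop (𝓝 ‖a - b‖) :=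
      (hla.sub hlb).norm
    have h2 : Tendsto (fun n => ‖(q (σ n)).1 - (q (σ n)).2‖) atTop (𝓝 0) := by
      refine squeeze_zero' (Eventually.of_forall fun n => norm_nonneg _) ?_
        ((tendsto_const_div_atTop_nhds_zero_nat L).comp hσ.tendsto_atTop)
      filter_upwards [hσ.tendsto_atTop.eventually_ge_atTop 1] with n hn
      have hn0 : (0 : ℝ) < σ n := by exact_mod_cast hn
      rw [Function.comp_apply, le_div_iff₀ hn0, mul_comm]
      exact hnorm (σ n)
    exact sub_eq_zero.1 (norm_eq_zero.1 (tendsto_nhds_unique h1 h2))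
  have haz : u z - w z ≤ u a - w a := by
    refine ge_of_tendsto' (((hu.tendsto a).comp hla).sub ((hw.tendsto a).comp hlb)) fun n => ?_
    have h := hqmax (σ n) (z, z) ⟨hz, hz⟩
    simp only [sub_self, norm_zero] at h
    have h2 : 0 ≤ (σ n : ℝ) * ‖(q (σ n)).1 - (q (σ n)).2‖ ^ 2 := by positivity
    simp only [Function.comp_apply]
    linarith
  -- The limit point does at least as well as `z`, which the contrary assumption excludes on the
  -- sphere; so both tests apply for large `n`.
  have haR : a ∈ Metric.ball (0 : E N) R := by
    rw [mem_ball_zero_iff]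
    exact lt_of_le_of_ne (mem_closedBall_zero_iff.1 haK) fun h => absurd haz (not_le.2 (hcon a h))
  have hmem := Metric.isOpen_ball.mem_nhds haR
  have h1 : H a p₀ ≤ f a := by
    refine le_of_tendsto_of_tendsto ((hH.tendsto (a, p₀)).comp (hla.prodMk_nhds hlp))
      ((hf.tendsto a).comp hla) ?_
    filter_upwards [hla.eventually_mem hmem] with n hn
    have h := hsub _ (contDiff_mul_norm_sub_sq (σ n) (q (σ n)).2) _ hn (by
      filter_upwards [Metric.isOpen_ball.mem_nhds hn] with y hy
      have := hqmax (σ n) (y, (q (σ n)).2) ⟨Metric.ball_subset_closedBall hy, (hq _).2⟩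
      dsimp only at this
      linarith)
    rwa [gradient_mul_norm_sub_sq] at h
  have h2 : g a ≤ H a p₀ := by
    refine le_of_tendsto_of_tendsto ((hg.tendsto a).comp hlb)
      ((hH.tendsto (a, p₀)).comp (hlb.prodMk_nhds hlp)) ?_
    filter_upwards [hlb.eventually_mem hmem] with n hn
    have h := hsuper _ (contDiff_mul_norm_sub_sq (-(σ n)) (q (σ n)).1) _ hn (by
      filter_upwards [Metric.isOpen_ball.mem_nhds hn] with y hy
      have := hqmax (σ n) ((q (σ n)).1, y) ⟨(hq _).1, Metric.ball_subset_closedBall hy⟩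
      dsimp only at this
      rw [norm_sub_rev y, norm_sub_rev (q (σ n)).2]
      linarith)
    rw [gradient_mul_norm_sub_sq, mul_neg, neg_smul, ← smul_neg, neg_sub] at h
    exact h
  linarith [hfg a]

/-- Convexity between `p` and `0` gives `H(x, μp) ≤ μ H(x, p)`. -/
lemma IsViscSub.const_mul {H : E N → E N → ℝ} {f v : E N → ℝ} (hconv : ConvexInMomentum H)
    (hH0 : ∀ x, H x 0 = 0) (hv : IsViscSub H f v) {μ : ℝ} (hμ0 : 0 < μ) (hμ1 : μ ≤ 1) :
    IsViscSub H (fun x => μ * f x) fun x => μ * v x := by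
  intro φ hφ x hmax
  have hd := hφ.differentiable one_ne_zero x
  have h := hv (fun y => μ⁻¹ * φ y) (contDiff_const.mul hφ) x (by
    filter_upwards [hmax] with y hy
    have := mul_le_mul_of_nonneg_left hy (inv_nonneg.2 hμ0.le)
    simpa only [mul_sub, inv_mul_cancel_left₀ hμ0.ne'] using this)
  rw [gradient_const_mul hd] at h
  have hc := (hconv x).2 (mem_univ (μ⁻¹ • gradient φ x)) (mem_univ 0) hμ0.le (sub_nonneg.2 hμ1)
    (by ring)
  rw [smul_inv_smul₀ hμ0.ne', smul_zero, add_zero, hH0, smul_zero, add_zero, smul_eq_mul] at hc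
  exact hc.trans (mul_le_mul_of_nonneg_left h hμ0.le)

lemma le_of_tendsto_sub_zero {H : E N → E N → ℝ} {l v w : E N → ℝ} {c : ℝ} (hl : Continuous l)
    (hl0 : ∀ x, 0 ≤ l x) (hH : Continuous (fun z : E N × E N => H z.1 z.2))
    (hH0 : ∀ x, H x 0 = 0) (hconv : ConvexInMomentum H) (hc : 0 < c)
    (hv : IsErgodicSolution H l c v) (hw : IsErgodicSolution H l c w)
    (hLip : ∀ R : ℝ, ∃ L : ℝ, 0 ≤ L ∧ ∀ x ∈ Metric.closedBall (0 : E N) R,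
      ∀ y ∈ Metric.closedBall (0 : E N) R, v x - v y ≤ L * ‖x - y‖)
    (hlim : Tendsto (fun x => v x - w x) (Bornology.cobounded (E N)) (𝓝 0)) (z : E N) :
    v z ≤ w z := by
  by_contra! hlt
  set δ := v z - w z
  have hδ : 0 < δ := sub_pos.2 hlt
  obtain ⟨R₀, -, hR₀⟩ := hasBasis_cobounded_norm.eventually_iff.1
    (hlim.eventually_lt_const (half_pos hδ))
  set R := max R₀ ‖z‖
  have hzR : z ∈ Metric.closedBall (0 : E N) R := by
    rw [mem_closedBall_zero_iff]
    exact le_max_right _ _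
  obtain ⟨L, hL0, hL⟩ := hLip R
  obtain ⟨M, hM⟩ := (isCompact_closedBall (0 : E N) R).exists_bound_of_continuousOn
    hv.continuous.continuousOn
  simp only [Real.norm_eq_abs] at hM
  have hM0 : 0 ≤ M := (abs_nonneg _).trans (hM z hzR)
  -- Scaling `v` by `1 - θ` changes it by at most `δ / 8` at `z` and on the sphere, less in total
  -- than the gap `δ / 2`; adding `δ` to `M` covers `M = 0` and gives `θ < 1`.
  set θ := δ / (8 * (M + δ))
  have hθ0 : 0 < θ := by positivity
  have hθ1 : θ < 1 := by
    rw [div_lt_one (by positivity)]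
    linarith
  have hθM : θ * M ≤ δ / 8 := by
    rw [div_mul_eq_mul_div, div_le_div_iff₀ (by positivity) (by norm_num)]
    nlinarith
  have hμ0 : 0 < 1 - θ := by linarith
  have hf : Continuous fun x => l x + c := hl.add continuous_const
  obtain ⟨b, hbR, hb⟩ := exists_sphere_sub_le (f := fun x => (1 - θ) * (l x + c))
    (u := fun x => (1 - θ) * v x) hH
    (continuous_const.mul hf) hf
    (fun x => by nlinarith [hl0 x]) (continuous_const.mul hv.continuous) hw.continuous hL0
    (fun x hx y hy => by
      have h := hL x hx y hy
      have h0 : 0 ≤ L * ‖x - y‖ := by positivity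
      rw [← mul_sub]
      nlinarith)
    ((hv.sub.const_mul hconv hH0 hμ0 (by linarith)).on _) (hw.super.on _) hzR
  have hMb := abs_le.1 (hM b (by rw [mem_closedBall_zero_iff, hbR]))
  have hMz := abs_le.1 (hM z hzR)
  have hbδ : v b - w b < δ / 2 := hR₀ (show R₀ ≤ ‖b‖ by rw [hbR]; exact le_max_left _ _)
  have h1 := mul_le_mul_of_nonneg_left hMb.1 hθ0.le
  have h2 := mul_le_mul_of_nonneg_left hMz.2 hθ0.le
  have hδ' : δ = v z - w z := rfl
  linarith

lemma LocallyLipschitz.exists_sub_le_on_closedBall {v : E N → ℝ} (hv : LocallyLipschitz v)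
    (R : ℝ) : ∃ L : ℝ, 0 ≤ L ∧ ∀ x ∈ Metric.closedBall (0 : E N) R,
      ∀ y ∈ Metric.closedBall (0 : E N) R, v x - v y ≤ L * ‖x - y‖ := by
  obtain ⟨L, hL⟩ := hv.locallyLipschitzOn.exists_lipschitzOnWith_of_compact
    (isCompact_closedBall (0 : E N) R)
  refine ⟨L, L.2, fun x hx y hy => ?_⟩
  rw [← dist_eq_norm]
  exact (le_abs_self _).trans (hL.dist_le_mul x hx y hy)

lemma SubsolutionsEquiLipschitz.exists_sub_le_on_closedBall {H : E N → E N → ℝ}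
    {f v : E N → ℝ} (hE : SubsolutionsEquiLipschitz H f) (hv : Continuous v)
    (hsub : IsViscSub H f v) (R : ℝ) : ∃ L : ℝ, 0 ≤ L ∧ ∀ x ∈ Metric.closedBall (0 : E N) R,
      ∀ y ∈ Metric.closedBall (0 : E N) R, v x - v y ≤ L * ‖x - y‖ := by
  obtain ⟨L, hL0, hL⟩ := hE (R + 1)
  have hsubset := Metric.closedBall_subset_ball (x := (0 : E N)) (lt_add_one R)
  exact ⟨L, hL0, fun x hx y hy => hL v hv hsub x (hsubset hx) y (hsubset hy)⟩

lemma eq_of_tendsto_sub_zero {H : E N → E N → ℝ} {l v w : E N → ℝ} {c : ℝ} (hl : Continuous l)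
    (hl0 : ∀ x, 0 ≤ l x) (hH : Continuous (fun z : E N × E N => H z.1 z.2))
    (hH0 : ∀ x, H x 0 = 0) (hconv : ConvexInMomentum H) (hc : 0 < c)
    (hv : IsErgodicSolution H l c v) (hw : IsErgodicSolution H l c w)
    (hLip : Coercive H ∨ (LocallyLipschitz v ∧ LocallyLipschitz w))
    (hlim : Tendsto (fun x => v x - w x) (Bornology.cobounded (E N)) (𝓝 0)) : v = w := by
  have hlim' : Tendsto (fun x => w x - v x) (Bornology.cobounded (E N)) (𝓝 0) := by
    simpa using hlim.neg
  have hf : Continuous fun x => l x + c := hl.add continuous_const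
  funext z
  rcases hLip with hcoer | ⟨hLv, hLw⟩
  · have hE := hcoer.subsolutionsEquiLipschitz hf
    exact le_antisymm
      (le_of_tendsto_sub_zero hl hl0 hH hH0 hconv hc hv hw
        (hE.exists_sub_le_on_closedBall hv.continuous hv.sub) hlim z)
      (le_of_tendsto_sub_zero hl hl0 hH hH0 hconv hc hw hv
        (hE.exists_sub_le_on_closedBall hw.continuous hw.sub) hlim' z)
  · exact le_antisymm
      (le_of_tendsto_sub_zero hl hl0 hH hH0 hconv hc hv hw
        (LocallyLipschitz.exists_sub_le_on_closedBall hLv) hlim z)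
      (le_of_tendsto_sub_zero hl hl0 hH hH0 hconv hc hw hv
        (LocallyLipschitz.exists_sub_le_on_closedBall hLw) hlim' z)

end ErgodicHJ

theorem theorem1p1 (N : ℕ) (hN : 1 ≤ N) (H : E N → E N → ℝ) (l : E N → ℝ)
    (hl : Continuous l) (hl0 : ∀ x, 0 ≤ l x)
    (hH : Continuous (fun z : E N × E N => H z.1 z.2)) :
    -- (i)
    (Coercive H → (∀ x, H x 0 = 0) →
      ∀ c : ℝ, 0 ≤ c → ∃ v : E N → ℝ, LocallyLipschitz v ∧ IsErgodicSolution H l c v) ∧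
    -- (ii)
    (ComparisonPrinciple H l →
      ∀ (c d : ℝ) (v w : E N → ℝ), IsErgodicSolution H l c v → IsErgodicSolution H l d w →
        BddAbove (range fun x => |v x - w x|) → c = d) ∧
    -- (iii)
    ((argminSet l).Nonempty → Coercive H → StrictlyMinimalAtZero H →
      (∃ v : E N → ℝ, LocallyLipschitz v ∧ IsErgodicSolution H l 0 v ∧ ∀ x, 0 ≤ v x) ∧
      (GrowthBound H → CompactnessCondition l →
        ∀ v : E N → ℝ, IsErgodicSolution H l 0 v → (∀ x, 0 ≤ v x) →
          Tendsto v (Bornology.cobounded (E N)) atTop)) ∧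
    -- (iv), first part
    (GrowthBound H →
      ∀ (c : ℝ) (v : E N → ℝ), 0 < c → IsErgodicSolution H l c v → ¬ BddBelow (range v)) ∧
    -- (iv), second part
    ((∀ x, H x 0 = 0) → ConvexInMomentum H →
      ∀ (c : ℝ) (v w : E N → ℝ), 0 < c →
        IsErgodicSolution H l c v → IsErgodicSolution H l c w →
        (Coercive H ∨ (LocallyLipschitz v ∧ LocallyLipschitz w)) →
        Tendsto (fun x => v x - w x) (Bornology.cobounded (E N)) (𝓝 0) → v = w) := by
  refine ⟨fun hcoer hH0 c hc => exists_isErgodicSolution hN hl hl0 hH hcoer hH0 hc, ?_,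
    fun hA hcoer hmin => ⟨exists_nonneg_isErgodicSolution hl hl0 hH hA hcoer hmin,
      fun hG hC v hv hv0 => tendsto_atTop_of_compactnessCondition hG hC hv hv0⟩,
    fun hG c v hc hv => not_bddBelow_range hl0 hG hc hv,
    fun hH0 hconv c v w hc hv hw hLip hlim =>
      eq_of_tendsto_sub_zero hl hl0 hH hH0 hconv hc hv hw hLip hlim⟩
  rintro hcp c d v w hv hw ⟨M, hM⟩
  have hM' : ∀ x, |v x - w x| ≤ M := fun x => hM (mem_range_self x)
  exact le_antisymm (hcp.constant_le hw hv fun x => abs_sub_comm (v x) (w x) ▸ hM' x)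
    (hcp.constant_le hv hw hM')
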